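/- Let $\Omega=\{0,1\}^{\mathbb N}$, with coordinates $\omega=(\omega_1,\omega_2,\dots)$, let $\ell(\omega)=\min\{n\ge 1:\omega_n=0\}$, and let $\tau:\Omega\to\Omega$ be the adding machine $$\tau(1,\dots,1,0,\omega_{\ell(\omega)+1},\dots)=(0,\dots,0,1,\omega_{\ell(\omega)+1},\dots),\qquad \tau(1,1,1,\dots)=(0,0,0,\dots).$$ Put $\phi=\ell-2$ (with an arbitrary integer value at $(1,1,1,\dots)$), $X=\Omega\times\mathbb Z$ and $T(\omega,n)=(\tau\omega,\,n+\phi(\omega))$. For $p\in(0,1)$ let $\mu_p$ be the product measure on $\Omega$ with $\mu_p([a_1,\dots,a_n])=p_{a_1}\cdots p_{a_n}$, $p_1=p$, $p_0=1-p$, and let $m_p$ be the measure on $X$ with $$m_p(A\times\{n\})=\mu_p(A)\Big(\frac{1-p}{p}\Big)^{-n}.$$ A conservative, ergodic, measure preserving transformation $S$ of a $\sigma$-finite measure space $(Y,\mathcal B,m)$ is called log-lower bounded (LLB) if there is $A\in\mathcal B$ with $0<m(A)<\infty$ and $\int_A\log\varphi_A\,dm<\infty$, where $\varphi_A(y)=\min\{n\ge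 1: S^n y\in A\}$. **Proposition 3.3.** For every $p\in(0,1)$, the Hajian–Ito–Kakutani transformation $(X,m_p,T)$ is LLB; in particular it is a conservative, ergodic, measure preserving transformation of the $\sigma$-finite measure space $(X,m_p)$. -/

import Mathlib

open MeasureTheory ProbabilityTheory
open scoped ENNReal

/-! ### Log-lower boundedness -/

section LLB

variable {X : Type*}

/-- The first return time `φ_A(x) = min {n ≥ 1 : T^n x ∈ A}`, equal to `∞` if the orbit of `x`
never enters `A` at a positive time. -/
noncomputable def returnTime (T : X → X) (A : Set X) (x : X) : ℕ∞ :=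
  ⨅ (n : ℕ) (_ : 1 ≤ n ∧ T^[n] x ∈ A), (n : ℕ∞)

/-- `log φ_A(x)`, an element of `[0, ∞]` since `φ_A ≥ 1`, with `log ∞ = ∞`. -/
noncomputable def logReturnTime (T : X → X) (A : Set X) (x : X) : ℝ≥0∞ :=
  (ENNReal.log ((returnTime T A x : ℕ∞) : ℝ≥0∞)).toENNReal

variable [MeasurableSpace X]

/-- The measurable sets `A` with `0 < m(A) < ∞` and `∫_A log φ_A dm < ∞`. -/
def logSets (T : X → X) (m : Measure X) : Set (Set X) :=
  {A | MeasurableSet A ∧ 0 < m A ∧ m A < ∞ ∧ ∫⁻ x in A, logReturnTime T A x ∂m < ∞}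

/-- `T` is a conservative, ergodic, measure preserving transformation of the σ-finite measure
space `(X, m)`; `Ergodic` includes measurability and preservation of `m`. -/
structure IsConservativeErgodic (T : X → X) (m : Measure X) : Prop where
  sigmaFinite : SigmaFinite m
  conservative : Conservative T m
  ergodic : Ergodic T m

/-- A conservative, ergodic, measure preserving transformation is log-lower bounded (LLB) if
there is a measurable set `A` with `0 < m(A) < ∞` and `∫_A log φ_A dm < ∞`. -/
structure IsLLB (T : X → X) (m : Measure X) : Prop extends IsConservativeErgodic T m where
  nonempty_logSets : (logSets T m).Nonempty

end LLB

/-! ### The Hajian–Ito–Kakutani transformation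

A point of `Ω = {0,1}^ℕ`, with coordinates `ω₁, ω₂, …`, is a function `ω : ℕ → Bool`;
`true` is the digit `1`, `false` the digit `0`, and the coordinate `ωₙ` is `ω (n - 1)`. -/

/-- `ℓ(ω) = min {n ≥ 1 : ωₙ = 0}`. (The value at `ω = (1, 1, 1, …)` is immaterial, since this
point is null.) -/
noncomputable def firstZero (ω : ℕ → Bool) : ℕ := sInf {i : ℕ | ω i = false} + 1

/-- The adding machine `τ(1,…,1,0,ω_{ℓ+1},…) = (0,…,0,1,ω_{ℓ+1},…)`; the digits of the initial
run of ones become `0`, the first zero becomes `1`, and the other digits do not change.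
(As usual, `(1, 1, 1, …)` is sent to `(0, 0, 0, …)`.) -/
def addingMachine (ω : ℕ → Bool) : ℕ → Bool := fun i =>
  if ∀ j ≤ i, ω j = true then false
  else if ∀ j < i, ω j = true then true
  else ω i

/-- The cocycle `φ = ℓ - 2`. -/
noncomputable def hikCocycle (ω : ℕ → Bool) : ℤ := (firstZero ω : ℤ) - 2

/-- The transformation `T(ω, n) = (τ ω, n + φ(ω))` of `X = Ω × ℤ`. -/
noncomputable def hikMap (x : (ℕ → Bool) × ℤ) : (ℕ → Bool) × ℤ :=
  (addingMachine x.1, x.2 + hikCocycle x.1)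

/-- The product measure `μ_p` on `Ω` whose digits are independent, equal to `1` with probability
`p` and to `0` with probability `1 - p`. -/
noncomputable def coinMeasure (p : unitInterval) : Measure (ℕ → Bool) :=
  Measure.infinitePi fun _ : ℕ => bernoulliMeasure true false p

/-- The measure on `ℤ` with mass `((1 - p) / p) ^ (-n)` at `n`. -/
noncomputable def heightMeasure (p : unitInterval) : Measure ℤ :=
  Measure.sum fun n : ℤ => ENNReal.ofReal (((1 - (p : ℝ)) / p) ^ (-n)) • Measure.dirac n

/-- The measure `m_p` on `Ω × ℤ`, with `m_p(A × {n}) = μ_p(A) ((1 - p) / p) ^ (-n)`. -/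
noncomputable def hikMeasure (p : unitInterval) : Measure ((ℕ → Bool) × ℤ) :=
  (coinMeasure p).prod (heightMeasure p)

/-! ### Prepending a digit -/

section Dynamics

/-! Write `q = 1 - p`. The map preserves `n + #{i < L : ωᵢ = 1}` once `L` exceeds the digits
changed. Conversely, points with the same tail and the same value of this invariant lie on one orbit
(`exists_iterate_hikMap_eq`). This rests on the self-similarity T²(bu, n) = (b·T(u, n)), where T
acts on the tail and the height (`hikMap_hikMap_consDigit`). Invariance of the measure: turning a
digit 0 into 1 multiplies `μ_p` by p/q, which is also the ratio of the masses of consecutive levels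
(`levelMass_mul_digitMass`). Ergodicity and conservativity: exchanging the blocks `[0, K)` and `[K,
2K)` keeps the tail and the number of ones, so it moves points along orbits within a level. For
large `K` such exchanges make cylinders independent, so they connect any two sets of positive
measure (`exists_blockSwap_inter_ne_zero`). An invariant set is thus null or full on each level, and
transitions between levels propagate nullity to the whole space. Connecting two disjoint halves of
one set gives recurrence. LLB: take A = Ω × {0}. Digits 1, 0 at places `i, i + 1` force a return
within 2^i steps, so log φ_A is at most linear in the place of the first such pair. The index of the
first pair equal to 1, 0 has a geometric tail, with failure probability p² + q < 1 per pair, hence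
finite mean. -/

/-- The sequence `b, u₀, u₁, …`. -/
def consDigit (b : Bool) (u : ℕ → Bool) : ℕ → Bool
  | 0 => b
  | i + 1 => u i

@[simp] lemma consDigit_zero (b : Bool) (u : ℕ → Bool) : consDigit b u 0 = b := rfl

@[simp] lemma consDigit_succ (b : Bool) (u : ℕ → Bool) (i : ℕ) : consDigit b u (i + 1) = u i := rfl

lemma exists_eq_consDigit (ω : ℕ → Bool) : ∃ b u, ω = consDigit b u :=
  ⟨ω 0, fun i => ω (i + 1), by ext i; cases i <;> rfl⟩

/-- The sequences with infinitely many digits `0`. -/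
def infZeros : Set (ℕ → Bool) := {ω | ∀ n, ∃ m ≥ n, ω m = false}

lemma consDigit_mem_infZeros {b : Bool} {u : ℕ → Bool} :
    consDigit b u ∈ infZeros ↔ u ∈ infZeros := by
  constructor
  · intro h n
    obtain ⟨m, hm, h0⟩ := h (n + 1)
    obtain ⟨k, rfl⟩ : ∃ k, m = k + 1 := ⟨m - 1, by omega⟩
    exact ⟨k, by omega, h0⟩
  · intro h n
    obtain ⟨m, hm, h0⟩ := h n
    exact ⟨m + 1, by omega, h0⟩

lemma addingMachine_consDigit_false (u : ℕ → Bool) :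
    addingMachine (consDigit false u) = consDigit true u := by
  ext i
  cases i with
  | zero => simp [addingMachine]
  | succ i =>
    have h1 : ¬ ∀ j ≤ i + 1, consDigit false u j = true := fun h => by simpa using h 0 (by omega)
    have h2 : ¬ ∀ j < i + 1, consDigit false u j = true := fun h => by simpa using h 0 (by omega)
    simp only [addingMachine, if_neg h1, if_neg h2, consDigit_succ]

lemma addingMachine_consDigit_true (u : ℕ → Bool) :
    addingMachine (consDigit true u) = consDigit false (addingMachine u) := by
  ext i
  cases i with
  | zero => simp [addingMachine]
  | succ i =>
    have h1 : (∀ j ≤ i + 1, consDigit true u j = true) ↔ ∀ j ≤ i, u j = true := by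
      refine ⟨fun h j hj => h (j + 1) (by omega), fun h j hj => ?_⟩
      cases j with
      | zero => rfl
      | succ j => exact h j (by omega)
    have h2 : (∀ j < i + 1, consDigit true u j = true) ↔ ∀ j < i, u j = true := by
      refine ⟨fun h j hj => h (j + 1) (by omega), fun h j hj => ?_⟩
      cases j with
      | zero => rfl
      | succ j => exact h j (by omega)
    simp only [addingMachine, h1, h2, consDigit_succ]

lemma firstZero_eq_of {ω : ℕ → Bool} {k : ℕ} (h1 : ∀ j < k, ω j = true) (h0 : ω k = false) :
    firstZero ω = k + 1 := by
  have hs : IsLeast {i : ℕ | ω i = false} k := by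
    refine ⟨h0, fun i hi => ?_⟩
    by_contra hlt
    simp [h1 i (by omega)] at hi
  rw [firstZero, hs.csInf_eq]

lemma exists_first_zero {u : ℕ → Bool} (h : ∃ m, u m = false) :
    ∃ k, (∀ j < k, u j = true) ∧ u k = false :=
  ⟨Nat.find h, fun j hj => by simpa using Nat.find_min h hj, Nat.find_spec h⟩

lemma hikMap_consDigit_false (u : ℕ → Bool) (n : ℤ) :
    hikMap (consDigit false u, n) = (consDigit true u, n - 1) := by
  have : firstZero (consDigit false u) = 0 + 1 := firstZero_eq_of (by simp) rfl
  simp only [hikMap, addingMachine_consDigit_false, hikCocycle, this]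
  congr 1

/-- The extra 1 lengthens the run of ones by one, and starting `u` one level higher absorbs this. At
the all-ones tail it fails, since there `sInf ∅ = 0` gives `firstZero` the value 1 with or without
the extra digit. -/
lemma hikMap_consDigit_true {u : ℕ → Bool} (h : ∃ m, u m = false) (n : ℤ) :
    hikMap (consDigit true u, n) =
      (consDigit false (hikMap (u, n + 1)).1, (hikMap (u, n + 1)).2) := by
  obtain ⟨k, h1, h0⟩ := exists_first_zero h
  have e : firstZero (consDigit true u) = k + 1 + 1 := by
    refine firstZero_eq_of (fun j hj => ?_) h0
    cases j with
    | zero => rfl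
    | succ j => exact h1 j (by omega)
  simp only [hikMap, addingMachine_consDigit_true, hikCocycle, e, firstZero_eq_of h1 h0]
  congr 1
  push_cast
  ring

lemma addingMachine_mem_infZeros {ω : ℕ → Bool} (h : ω ∈ infZeros) :
    addingMachine ω ∈ infZeros := by
  obtain ⟨k, -, h0⟩ := h 0
  intro n
  obtain ⟨m, hm, hm0⟩ := h (max n (k + 1))
  refine ⟨m, le_trans (le_max_left _ _) hm, ?_⟩
  have hk : k < m := le_trans (le_max_right n (k + 1)) hm
  have h2 : ¬ ∀ j < m, ω j = true := fun h => by simp [h k hk] at h0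
  simp [addingMachine, hm0, h2]

lemma iterate_hikMap_mem_infZeros {ω : ℕ → Bool} (h : ω ∈ infZeros) (n : ℤ) (k : ℕ) :
    (hikMap^[k] (ω, n)).1 ∈ infZeros := by
  induction k with
  | zero => exact h
  | succ k ih =>
    rw [Function.iterate_succ_apply']
    exact addingMachine_mem_infZeros ih

/-- In two steps the first digit flips twice and carries exactly once; the height changes -1 and +1
due to that digit cancel. -/
lemma hikMap_hikMap_consDigit {u : ℕ → Bool} (h : u ∈ infZeros) (b : Bool) (n : ℤ) :
    hikMap (hikMap (consDigit b u, n)) = (consDigit b (hikMap (u, n)).1, (hikMap (u, n)).2) := by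
  obtain ⟨m, -, hm⟩ := h 0
  cases b
  · rw [hikMap_consDigit_false, hikMap_consDigit_true ⟨m, hm⟩, sub_add_cancel]
  · rw [hikMap_consDigit_true ⟨m, hm⟩, hikMap_consDigit_false]
    simp only [hikMap]
    congr 1
    ring

lemma iterate_two_mul_hikMap_consDigit {u : ℕ → Bool} (h : u ∈ infZeros) (b : Bool) (n : ℤ)
    (k : ℕ) : hikMap^[2 * k] (consDigit b u, n) =
      (consDigit b (hikMap^[k] (u, n)).1, (hikMap^[k] (u, n)).2) := by
  induction k with
  | zero => rfl
  | succ k ih =>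
    rw [show 2 * (k + 1) = 2 * k + 1 + 1 by ring, Function.iterate_succ_apply',
      Function.iterate_succ_apply', ih,
      hikMap_hikMap_consDigit (iterate_hikMap_mem_infZeros h n k), Prod.mk.eta,
      ← Function.iterate_succ_apply' hikMap k]

/-! ### Orbits described by the tail and the invariant -/

/-- The number of digits `1` among the first `L` ones. -/
def onesCount (ω : ℕ → Bool) (L : ℕ) : ℤ := ∑ i ∈ Finset.range L, ((ω i).toNat : ℤ)

lemma onesCount_consDigit (b : Bool) (u : ℕ → Bool) (L : ℕ) :
    onesCount (consDigit b u) (L + 1) = onesCount u L + b.toNat := by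
  simp [onesCount, Finset.sum_range_succ']

/-- Two points with the same tail and the same value of the invariant `n + #{i : ωᵢ = 1}` lie
on the same orbit. -/
lemma exists_iterate_hikMap_eq (L : ℕ) : ∀ (ω ω' : ℕ → Bool) (n n' : ℤ), ω ∈ infZeros →
    (∀ i ≥ L, ω i = ω' i) → n + onesCount ω L = n' + onesCount ω' L →
    (∃ k, hikMap^[k] (ω, n) = (ω', n')) ∨ ∃ k, hikMap^[k] (ω', n') = (ω, n) := by
  induction L with
  | zero =>
    intro ω ω' n n' _ h e
    have : ω = ω' := funext fun i => h i (by omega)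
    subst this
    have : n = n' := by simpa using e
    subst this
    exact Or.inl ⟨0, rfl⟩
  | succ L ih =>
    have lift_eq : ∀ (b : Bool) (u u' : ℕ → Bool) (n n' : ℤ) (k : ℕ), u ∈ infZeros →
        hikMap^[k] (u, n) = (u', n') →
        hikMap^[2 * k] (consDigit b u, n) = (consDigit b u', n') := by
      intro b u u' n n' k hu hk
      rw [iterate_two_mul_hikMap_consDigit hu, hk]
    have up : ∀ (u u' : ℕ → Bool) (n n' : ℤ) (k : ℕ), u ∈ infZeros →
        hikMap^[k] (u, n) = (u', n' + 1) →
        ∃ k, hikMap^[k] (consDigit false u, n) = (consDigit true u', n') := by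
      intro u u' n n' k hu hk
      refine ⟨2 * k + 1, ?_⟩
      rw [Function.iterate_succ_apply', lift_eq false u u' n (n' + 1) k hu hk,
        hikMap_consDigit_false, add_sub_cancel_right]
    -- Since (1u, n) is the image of (0u, n + 1), it lies one step along the lifted path of length
    -- 2k. If `k = 0` there is no step to drop, and the order on the orbit is reversed.
    have down : ∀ (u u' : ℕ → Bool) (n n' : ℤ) (k : ℕ), u ∈ infZeros →
        hikMap^[k] (u, n + 1) = (u', n') →
        (∃ k, hikMap^[k] (consDigit true u, n) = (consDigit false u', n')) ∨
          ∃ k, hikMap^[k] (consDigit false u', n') = (consDigit true u, n) := by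
      intro u u' n n' k hu hk
      cases k with
      | zero =>
        right
        obtain ⟨rfl, rfl⟩ := Prod.mk.inj hk
        exact ⟨1, by rw [Function.iterate_one, hikMap_consDigit_false, add_sub_cancel_right]⟩
      | succ k =>
        left
        refine ⟨2 * k + 1, ?_⟩
        have := lift_eq false u u' (n + 1) n' (k + 1) hu hk
        rwa [show 2 * (k + 1) = 2 * k + 1 + 1 by ring, Function.iterate_succ_apply,
          hikMap_consDigit_false, add_sub_cancel_right] at this
    intro ω ω' n n' hω h e
    obtain ⟨b, u, rfl⟩ := exists_eq_consDigit ω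
    obtain ⟨b', u', rfl⟩ := exists_eq_consDigit ω'
    have hu := consDigit_mem_infZeros.1 hω
    have ht : ∀ i ≥ L, u i = u' i := fun i hi => h (i + 1) (by omega)
    have hu' : u' ∈ infZeros := fun m => by
      obtain ⟨j, hj, h0⟩ := hu (max m L)
      exact ⟨j, le_trans (le_max_left _ _) hj, by rw [← ht j (le_trans (le_max_right _ _) hj), h0]⟩
    rw [onesCount_consDigit, onesCount_consDigit] at e
    cases b <;> cases b' <;>
      simp only [Bool.toNat_false, Bool.toNat_true, Nat.cast_zero, Nat.cast_one] at e
    · exact (ih u u' n n' hu ht (by linarith)).imp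
        (fun ⟨k, hk⟩ => ⟨_, lift_eq _ _ _ _ _ _ hu hk⟩)
        (fun ⟨k, hk⟩ => ⟨_, lift_eq _ _ _ _ _ _ hu' hk⟩)
    · rcases ih u u' n (n' + 1) hu ht (by linarith) with ⟨k, hk⟩ | ⟨k, hk⟩
      · exact Or.inl (up _ _ _ _ _ hu hk)
      · exact (down _ _ _ _ _ hu' hk).symm
    · rcases ih u u' (n + 1) n' hu ht (by linarith) with ⟨k, hk⟩ | ⟨k, hk⟩
      · exact down _ _ _ _ _ hu hk
      · exact Or.inr (up _ _ _ _ _ hu' hk)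
    · exact (ih u u' n n' hu ht (by linarith)).imp
        (fun ⟨k, hk⟩ => ⟨_, lift_eq _ _ _ _ _ _ hu hk⟩)
        (fun ⟨k, hk⟩ => ⟨_, lift_eq _ _ _ _ _ _ hu' hk⟩)

/-- If the digits `1, 0` stand at the places `i, i + 1`, then `2 ^ i` steps exchange them. -/
lemma iterate_two_pow_hikMap_snd (i : ℕ) : ∀ (ω : ℕ → Bool) (n : ℤ), ω ∈ infZeros →
    ω i = true → ω (i + 1) = false → (hikMap^[2 ^ i] (ω, n)).2 = n := by
  induction i with
  | zero =>
    intro ω n _ h1 h0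
    have : firstZero ω = 1 + 1 := firstZero_eq_of (fun j hj => by
      obtain rfl : j = 0 := by omega
      exact h1) h0
    simp [hikMap, hikCocycle, this]
  | succ i ih =>
    intro ω n hω h1 h0
    obtain ⟨b, u, rfl⟩ := exists_eq_consDigit ω
    have hu := consDigit_mem_infZeros.1 hω
    -- Doubling the number of steps lets the same motion act behind one more fixed digit.
    rw [pow_succ', iterate_two_mul_hikMap_consDigit hu]
    exact ih u n hu h1 h0

end Dynamics

/-! ### The coin-tossing measure -/

section Coin

instance (p : unitInterval) : IsProbabilityMeasure (coinMeasure p) := by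
  unfold coinMeasure; infer_instance

/-- The probability of the digit `b`. -/
noncomputable def digitMass (p : unitInterval) (b : Bool) : ℝ≥0∞ :=
  bernoulliMeasure true false p {b}

lemma digitMass_true (p : unitInterval) : digitMass p true = ENNReal.ofReal p := by
  rw [digitMass, bernoulliMeasure_apply_of_mem_of_notMem p (by measurability) (by simp) (by simp)]
  rw [ENNReal.ofReal, ENNReal.coe_inj]
  ext
  simp [p.2.1]

lemma digitMass_false (p : unitInterval) : digitMass p false = ENNReal.ofReal (1 - p) := by
  rw [digitMass, bernoulliMeasure_apply_of_notMem_of_mem p (by measurability) (by simp) (by simp)]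
  rw [ENNReal.ofReal, ENNReal.coe_inj]
  ext
  simp [p.2.2]

lemma bernoulliMeasure_eq_digitMass (p : unitInterval) (t : Set Bool) :
    bernoulliMeasure true false p t =
      t.indicator (fun _ => digitMass p true) true +
        t.indicator (fun _ => digitMass p false) false := by
  classical
  have h : digitMass p true + digitMass p false = 1 := by
    rw [digitMass_true, digitMass_false, ← ENNReal.ofReal_add p.2.1 (by linarith [p.2.2])]
    simp
  by_cases h1 : true ∈ t <;> by_cases h0 : false ∈ t <;>
    simp only [Set.indicator, h1, h0, if_true, if_false, h, add_zero, zero_add,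
      bernoulliMeasure_apply p (MeasurableSet.of_discrete (s := t))] <;>
    simp [digitMass]

lemma digitMass_add (p : unitInterval) : digitMass p true + digitMass p false = 1 := by
  have := bernoulliMeasure_eq_digitMass p Set.univ
  simpa using this.symm

lemma digitMass_ne_top (p : unitInterval) (b : Bool) : digitMass p b ≠ ∞ :=
  measure_ne_top _ _

lemma digitMass_ne_zero {p : unitInterval} (hp0 : 0 < (p : ℝ)) (hp1 : (p : ℝ) < 1) (b : Bool) :
    digitMass p b ≠ 0 := by
  cases b
  · rw [digitMass_false]; simpa using hp1
  · rw [digitMass_true]; simpa using hp0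

lemma digitMass_lt_one {p : unitInterval} (hp0 : 0 < (p : ℝ)) (hp1 : (p : ℝ) < 1) (b : Bool) :
    digitMass p b < 1 := by
  cases b
  · rw [digitMass_false]; simpa using hp0
  · rw [digitMass_true]; simpa using hp1

@[fun_prop]
lemma measurable_consDigit (b : Bool) : Measurable (consDigit b) := by
  refine measurable_pi_iff.2 fun i => ?_
  cases i with
  | zero => exact measurable_const
  | succ i => exact measurable_pi_apply i

lemma coinMeasure_eq_add_map_consDigit (p : unitInterval) :
    coinMeasure p = digitMass p true • (coinMeasure p).map (consDigit true) +
      digitMass p false • (coinMeasure p).map (consDigit false) := by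
  classical
  symm
  refine Measure.eq_infinitePi _ fun s t ht => ?_
  obtain ⟨N, hN⟩ : ∃ N, s ⊆ Finset.range (N + 1) :=
    ⟨s.sup id, fun i hi => Finset.mem_range_succ_iff.2 (Finset.le_sup (f := id) hi)⟩
  -- Padding the box with `Set.univ` makes its index set an initial segment containing 0, so
  -- removing the first digit is a shift.
  set t' : ℕ → Set Bool := fun i => if i ∈ s then t i else Set.univ with ht'
  have e : Set.pi (s : Set ℕ) t = Set.pi (Finset.range (N + 1) : Set ℕ) t' := by
    ext ω
    simp only [Set.mem_pi, ht']
    refine ⟨fun h i _ => ?_, fun h i hi => ?_⟩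
    · split_ifs with hi
      · exact h i hi
      · trivial
    · have := h i (hN hi)
      rwa [if_pos (by exact_mod_cast hi)] at this
  have e2 : ∏ i ∈ s, bernoulliMeasure true false p (t i) =
      ∏ i ∈ Finset.range (N + 1), bernoulliMeasure true false p (t' i) := by
    rw [← Finset.prod_subset hN]
    · exact Finset.prod_congr rfl fun i hi => by simp [ht', hi]
    · intro i _ hi
      simp [ht', hi]
  have pre : ∀ b : Bool, (coinMeasure p).map (consDigit b)
      (Set.pi (Finset.range (N + 1) : Set ℕ) t') =
      (t' 0).indicator (fun _ => 1) b *
        ∏ i ∈ Finset.range N, bernoulliMeasure true false p (t' (i + 1)) := by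
    intro b
    rw [Measure.map_apply (measurable_consDigit b)
      (.pi (Finset.countable_toSet _) fun _ _ => .of_discrete)]
    by_cases hb : b ∈ t' 0
    · have : consDigit b ⁻¹' Set.pi (Finset.range (N + 1) : Set ℕ) t' =
          Set.pi (Finset.range N : Set ℕ) fun i => t' (i + 1) := by
        ext u
        simp only [Set.mem_preimage, Set.mem_pi, Finset.coe_range, Set.mem_Iio]
        refine ⟨fun h i hi => h (i + 1) (by omega), fun h i hi => ?_⟩
        cases i with
        | zero => exact hb
        | succ i => exact h i (by omega)
      rw [this, coinMeasure, Measure.infinitePi_pi _ fun _ _ => .of_discrete]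
      simp [hb]
    · have : consDigit b ⁻¹' Set.pi (Finset.range (N + 1) : Set ℕ) t' = ∅ := by
        ext u
        simp only [Set.mem_preimage, Set.mem_pi, Set.mem_empty_iff_false, iff_false]
        exact fun h => hb (h 0 (by simp))
      rw [this]
      simp [hb]
  rw [e2, e, Finset.prod_range_succ', bernoulliMeasure_eq_digitMass p (t' 0)]
  simp only [Measure.add_apply, Measure.smul_apply, pre, smul_eq_mul]
  by_cases h1 : true ∈ t' 0 <;> by_cases h0 : false ∈ t' 0 <;> simp [h1, h0] <;> ring

lemma coinMeasure_apply (p : unitInterval) {A : Set (ℕ → Bool)} (hA : MeasurableSet A) :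
    coinMeasure p A = digitMass p true * coinMeasure p (consDigit true ⁻¹' A) +
      digitMass p false * coinMeasure p (consDigit false ⁻¹' A) := by
  conv_lhs => rw [coinMeasure_eq_add_map_consDigit]
  simp [Measure.map_apply (measurable_consDigit _) hA]

/-- Each prescribed digit costs a factor at most `M < 1`, and arbitrarily many are prescribed. -/
lemma coinMeasure_eventually_eq {p : unitInterval} (hp0 : 0 < (p : ℝ)) (hp1 : (p : ℝ) < 1)
    (c : ℕ → Bool) (n : ℕ) : coinMeasure p {ω | ∀ m ≥ n, ω m = c m} = 0 := by
  set M := max (digitMass p true) (digitMass p false)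
  have hM : M < 1 := max_lt (digitMass_lt_one hp0 hp1 _) (digitMass_lt_one hp0 hp1 _)
  have hle : ∀ k : ℕ, coinMeasure p {ω | ∀ m ≥ n, ω m = c m} ≤ M ^ k := by
    intro k
    calc coinMeasure p {ω | ∀ m ≥ n, ω m = c m}
        ≤ coinMeasure p (Set.pi (Finset.Ico n (n + k) : Set ℕ) fun m => {c m}) := by
          refine measure_mono fun ω h m hm => ?_
          exact h m (Finset.mem_Ico.1 (by exact_mod_cast hm)).1
      _ = ∏ m ∈ Finset.Ico n (n + k), digitMass p (c m) :=
          Measure.infinitePi_pi _ fun _ _ => .of_discrete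
      _ ≤ ∏ m ∈ Finset.Ico n (n + k), M := Finset.prod_le_prod' fun m _ => by
          cases c m
          · exact le_max_right _ _
          · exact le_max_left _ _
      _ = M ^ k := by simp
  exact le_antisymm (ge_of_tendsto' (ENNReal.tendsto_pow_atTop_nhds_zero_of_lt_one hM) hle)
    zero_le

lemma ae_mem_infZeros {p : unitInterval} (hp0 : 0 < (p : ℝ)) (hp1 : (p : ℝ) < 1) :
    ∀ᵐ ω ∂coinMeasure p, ω ∈ infZeros := by
  refine ae_all_iff.2 fun n => ?_
  refine measure_mono_null (t := {ω | ∀ m ≥ n, ω m = true}) (fun ω h m hm => ?_)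
    (coinMeasure_eventually_eq hp0 hp1 (fun _ => true) n)
  by_contra h0
  exact h ⟨m, hm, by simpa using h0⟩

/-- A set of positive measure meets both `{ωᵢ = 0}` and `{ωᵢ = 1}` in positive measure,
for some `i`. -/
lemma exists_digit_split {p : unitInterval} (hp0 : 0 < (p : ℝ)) (hp1 : (p : ℝ) < 1)
    {s : Set (ℕ → Bool)} (hs : coinMeasure p s ≠ 0) :
    ∃ i, ∀ b, coinMeasure p (s ∩ {ω | ω i = b}) ≠ 0 := by
  by_contra! h
  -- If every place fails, almost every point of `s` avoids the digit `c i` at every `i`, leaving a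
  -- single sequence, which is null.
  choose c hc using h
  refine hs (measure_mono_null (t := (⋃ i, s ∩ {ω | ω i = c i}) ∪
    {ω | ∀ m ≥ 0, ω m = (fun i => !c i) m}) (fun ω hω => ?_)
    (measure_union_null (measure_iUnion_null hc) (coinMeasure_eventually_eq hp0 hp1 _ 0)))
  by_cases hi : ∃ i, ω i = c i
  · obtain ⟨i, hi⟩ := hi
    exact Or.inl (Set.mem_iUnion.2 ⟨i, hω, hi⟩)
  · right
    intro m _
    have := fun h => hi ⟨m, h⟩
    simpa [Bool.eq_not_iff] using this

/-! ### Block exchanges and independence -/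

/-- The permutation of `ℕ` exchanging the blocks `[0, K)` and `[K, 2K)`. -/
def blockSwapFun (K i : ℕ) : ℕ := if i < K then i + K else if i < 2 * K then i - K else i

lemma blockSwapFun_involutive (K : ℕ) : Function.Involutive (blockSwapFun K) := by
  intro i
  unfold blockSwapFun
  split_ifs <;> omega

lemma blockSwapFun_lt_iff (K i : ℕ) : blockSwapFun K i < 2 * K ↔ i < 2 * K := by
  unfold blockSwapFun
  split_ifs <;> omega

lemma measurePreserving_blockSwap (p : unitInterval) (K : ℕ) :
    MeasurePreserving (fun (ω : ℕ → Bool) i => ω (blockSwapFun K i)) (coinMeasure p)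
      (coinMeasure p) where
  measurable := by fun_prop
  map_eq := Measure.map_infinitePi_infinitePi_of_inj (P := fun _ : ℕ =>
    bernoulliMeasure true false p) (blockSwapFun_involutive K).injective

lemma onesCount_blockSwap (ω : ℕ → Bool) (K : ℕ) :
    onesCount (fun i => ω (blockSwapFun K i)) (2 * K) = onesCount ω (2 * K) := by
  refine Finset.sum_equiv (blockSwapFun_involutive K).toPerm (fun i => ?_) fun i _ => rfl
  simp [blockSwapFun_lt_iff]

lemma exists_measurableCylinder_approx (p : unitInterval) {s : Set (ℕ → Bool)}
    (hs : MeasurableSet s) {ε : ℝ≥0∞} (hε : 0 < ε) :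
    ∃ t ∈ measurableCylinders fun _ : ℕ => Bool, coinMeasure p (symmDiff t s) < ε :=
  exists_measure_symmDiff_lt_of_generateFrom_isSetRing isSetAlgebra_measurableCylinders.isSetRing
    ⟨{Set.univ}, by simp, 
      Set.singleton_subset_iff.2 isSetAlgebra_measurableCylinders.univ_mem, by simp⟩
    generateFrom_measurableCylinders.symm hs hε

/-- The exchange moves the places of `J` into `[K, 2K)`, disjoint from those of `I`. -/
lemma coinMeasure_inter_blockSwap_cylinder (p : unitInterval) {I J : Finset ℕ} {K : ℕ}
    (hI : ∀ i ∈ I, i < K) (hJ : ∀ i ∈ J, i < K)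
    {S : Set (∀ _ : I, Bool)} {U : Set (∀ _ : J, Bool)} :
    coinMeasure p (cylinder I S ∩ (fun ω i => ω (blockSwapFun K i)) ⁻¹' cylinder J U) =
      coinMeasure p (cylinder I S) * coinMeasure p (cylinder J U) := by
  classical
  have hind : iIndepFun (fun (i : ℕ) (ω : ℕ → Bool) => ω i) (coinMeasure p) :=
    iIndepFun_infinitePi (P := fun _ : ℕ => bernoulliMeasure true false p)
      (X := fun _ b => b) fun _ => measurable_id
  have hdisj : Disjoint I (J.image (blockSwapFun K)) := by
    rw [Finset.disjoint_left]
    intro i hi hi'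
    obtain ⟨j, hj, rfl⟩ := Finset.mem_image.1 hi'
    have h1 := hI _ hi
    have h2 := hJ _ hj
    simp only [blockSwapFun, if_pos h2] at h1
    omega
  have h := hind.indepFun_finset I (J.image (blockSwapFun K)) hdisj fun i => measurable_pi_apply i
  have h2 := h.comp (φ := id)
    (ψ := fun (f : ∀ _ : J.image (blockSwapFun K), Bool) (j : J) =>
      f ⟨blockSwapFun K j, Finset.mem_image_of_mem _ j.2⟩) measurable_id (by fun_prop)
  have h3 := h2.measure_inter_preimage_eq_mul S U .of_discrete .of_discrete
  rw [← (measurePreserving_blockSwap p K).measure_preimage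
    (MeasurableSet.cylinder J (S := U) .of_discrete).nullMeasurableSet]
  exact h3

/-- Two sets of positive measure are connected by some exchange of blocks. -/
lemma exists_blockSwap_inter_ne_zero (p : unitInterval) {s t : Set (ℕ → Bool)}
    (hs : MeasurableSet s) (ht : MeasurableSet t) (hs0 : coinMeasure p s ≠ 0)
    (ht0 : coinMeasure p t ≠ 0) :
    ∃ K, coinMeasure p (s ∩ (fun ω i => ω (blockSwapFun K i)) ⁻¹' t) ≠ 0 := by
  set a := (coinMeasure p).real s
  set b := (coinMeasure p).real t
  have ha : 0 < a := by simpa [a, measureReal_def, ENNReal.toReal_pos_iff, pos_iff_ne_zero] using hs0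
  have hb : 0 < b := by simpa [b, measureReal_def, ENNReal.toReal_pos_iff, pos_iff_ne_zero] using ht0
  have ha1 : a ≤ 1 := measureReal_le_one
  have hb1 : b ≤ 1 := measureReal_le_one
  -- With ε = ab/5 and a, b ≤ 1, independence gives the cylinders an overlap of at least (a - ε)(b -
  -- ε) > 3ab/5 - 0, up to equality only excluded by ε² > 0, while a null intersection would force
  -- it below 2ε = 2ab/5.
  have hε : 0 < a * b / 5 := by positivity
  have approx : ∀ u : Set (ℕ → Bool), MeasurableSet u → ∃ v ∈ measurableCylinders fun _ : ℕ => Bool,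
      (coinMeasure p).real (symmDiff v u) < a * b / 5 := by
    intro u hu
    obtain ⟨v, hv, h⟩ := exists_measurableCylinder_approx p hu (ENNReal.ofReal_pos.2 hε)
    refine ⟨v, hv, ?_⟩
    rw [measureReal_def]
    exact (ENNReal.lt_ofReal_iff_toReal_lt (measure_ne_top _ _)).1 h
  obtain ⟨s', hs', hss⟩ := approx s hs
  obtain ⟨t', ht', htt⟩ := approx t ht
  obtain ⟨I, S, -, rfl⟩ := (mem_measurableCylinders _).1 hs'
  obtain ⟨J, U, -, rfl⟩ := (mem_measurableCylinders _).1 ht'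
  set s' : Set (ℕ → Bool) := cylinder (α := fun _ => Bool) I S
  set t' : Set (ℕ → Bool) := cylinder (α := fun _ => Bool) J U
  have ms' : MeasurableSet s' := .of_mem_measurableCylinders hs'
  have mt' : MeasurableSet t' := .of_mem_measurableCylinders ht'
  obtain ⟨K, hK⟩ : ∃ K, ∀ i ∈ I ∪ J, i < K :=
    ⟨(I ∪ J).sup id + 1, fun i hi => Nat.lt_succ_of_le (Finset.le_sup (f := id) hi)⟩
  refine ⟨K, fun h0 => ?_⟩
  set σ : (ℕ → Bool) → ℕ → Bool := fun ω i => ω (blockSwapFun K i)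
  have hσ : MeasurePreserving σ (coinMeasure p) (coinMeasure p) := measurePreserving_blockSwap p K
  have hmul : (coinMeasure p).real (s' ∩ σ ⁻¹' t') =
      (coinMeasure p).real s' * (coinMeasure p).real t' := by
    simp only [measureReal_def, ← ENNReal.toReal_mul]
    congr 1
    exact coinMeasure_inter_blockSwap_cylinder p (fun i hi => hK i (Finset.mem_union_left _ hi))
      (fun i hi => hK i (Finset.mem_union_right _ hi))
  have hσt : (coinMeasure p).real (σ ⁻¹' symmDiff t' t) = (coinMeasure p).real (symmDiff t' t) := by
    simp only [measureReal_def]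
    rw [hσ.measure_preimage (mt'.symmDiff ht).nullMeasurableSet]
  have hsub : s' ∩ σ ⁻¹' t' ⊆ (s ∩ σ ⁻¹' t) ∪ (symmDiff s' s ∪ σ ⁻¹' symmDiff t' t) := by
    intro ω ⟨h1, h2⟩
    by_cases h3 : ω ∈ s
    · by_cases h4 : σ ω ∈ t
      · exact Or.inl ⟨h3, h4⟩
      · exact Or.inr (Or.inr (Or.inl ⟨h2, h4⟩))
    · exact Or.inr (Or.inl (Or.inl ⟨h1, h3⟩))
  have h00 : (coinMeasure p).real (s ∩ σ ⁻¹' t) = 0 := by simp [measureReal_def, h0]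
  have key : (coinMeasure p).real (s' ∩ σ ⁻¹' t') < 2 * (a * b / 5) := by
    calc _ ≤ _ := measureReal_mono hsub
      _ ≤ _ := measureReal_union_le _ _
      _ ≤ 0 + ((coinMeasure p).real (symmDiff s' s) +
          (coinMeasure p).real (σ ⁻¹' symmDiff t' t)) :=
        add_le_add h00.le (measureReal_union_le _ _)
      _ < 2 * (a * b / 5) := by rw [hσt]; linarith
  have low : ∀ u v : Set (ℕ → Bool), (coinMeasure p).real v ≤
      (coinMeasure p).real u + (coinMeasure p).real (symmDiff u v) := by
    intro u v
    refine (measureReal_mono (fun ω h => ?_)).trans (measureReal_union_le _ _)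
    by_cases hu : ω ∈ u
    · exact Or.inl hu
    · exact Or.inr (Or.inr ⟨h, hu⟩)
  have h1 : a ≤ (coinMeasure p).real s' + a * b / 5 := (low s' s).trans (by linarith)
  have h2 : b ≤ (coinMeasure p).real t' + a * b / 5 := (low t' t).trans (by linarith)
  rw [hmul] at key
  have hab : a * b ≤ a := by nlinarith
  have hab' : a * b ≤ b := by nlinarith
  have h3 : (a - a * b / 5) * (b - a * b / 5) ≤
      (coinMeasure p).real s' * (coinMeasure p).real t' :=
    mul_le_mul (by linarith) (by linarith) (by linarith) measureReal_nonneg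
  nlinarith [mul_pos ha hb, mul_le_mul_of_nonneg_left hb1 (mul_pos ha hb).le,
    mul_le_mul_of_nonneg_left ha1 (mul_pos ha hb).le]

end Coin

/-! ### The invariant measure -/

section HIKMeasure

/-- The mass of `Ω × {n}`. -/
noncomputable def levelMass (p : unitInterval) (n : ℤ) : ℝ≥0∞ :=
  ENNReal.ofReal (((1 - (p : ℝ)) / p) ^ (-n))

lemma levelMass_ne_zero {p : unitInterval} (hp0 : 0 < (p : ℝ)) (hp1 : (p : ℝ) < 1) (n : ℤ) :
    levelMass p n ≠ 0 := by
  have : 0 < ((1 - (p : ℝ)) / p) ^ (-n) := zpow_pos (div_pos (by linarith) hp0) _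
  simpa [levelMass] using this

/-- Detailed balance: moving down one level while turning a 0 into a 1 preserves mass. -/
lemma levelMass_mul_digitMass {p : unitInterval} (hp0 : 0 < (p : ℝ)) (hp1 : (p : ℝ) < 1) (n : ℤ) :
    levelMass p (n + 1) * digitMass p false = levelMass p n * digitMass p true := by
  have hr : 0 < (1 - (p : ℝ)) / p := div_pos (by linarith) hp0
  rw [levelMass, levelMass, digitMass_true, digitMass_false,
    ← ENNReal.ofReal_mul (zpow_pos hr _).le, ← ENNReal.ofReal_mul (zpow_pos hr _).le]
  congr 1
  rw [show -n = -(n + 1) + 1 by ring, zpow_add₀ hr.ne', zpow_one]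
  field_simp

instance (p : unitInterval) : SigmaFinite (heightMeasure p) := by
  refine ⟨⟨⟨fun k => Finset.Icc (-(k : ℤ)) k, fun _ => trivial, fun k => ?_, ?_⟩⟩⟩
  · refine (Finset.finite_toSet _).induction_on _ (by simp) fun {a s} _ _ h => ?_
    rw [Set.insert_eq]
    refine (measure_union_le _ _).trans_lt (ENNReal.add_lt_top.2 ⟨?_, h⟩)
    rw [heightMeasure, Measure.sum_apply _ .of_discrete, tsum_eq_single a]
    · simp
    · intro b hb
      simp [hb]
  · refine Set.eq_univ_of_forall fun n => Set.mem_iUnion.2 ⟨n.natAbs, ?_⟩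
    simp only [Finset.coe_Icc, Set.mem_Icc]
    omega

instance (p : unitInterval) : SigmaFinite (hikMeasure p) := by
  unfold hikMeasure; infer_instance

lemma hikMeasure_apply (p : unitInterval) {B : Set ((ℕ → Bool) × ℤ)} (hB : MeasurableSet B) :
    hikMeasure p B = ∑' n, levelMass p n * coinMeasure p {ω | (ω, n) ∈ B} := by
  rw [hikMeasure, Measure.prod_apply_symm hB, heightMeasure, lintegral_sum_measure]
  refine tsum_congr fun n => ?_
  rw [lintegral_smul_measure, lintegral_dirac]
  rfl

lemma measurableSet_level {B : Set ((ℕ → Bool) × ℤ)} (hB : MeasurableSet B) (n : ℤ) :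
    MeasurableSet {ω | (ω, n) ∈ B} :=
  hB.preimage (by fun_prop)

lemma hikMeasure_eq_zero_iff {p : unitInterval} (hp0 : 0 < (p : ℝ)) (hp1 : (p : ℝ) < 1)
    {B : Set ((ℕ → Bool) × ℤ)} (hB : MeasurableSet B) :
    hikMeasure p B = 0 ↔ ∀ n, coinMeasure p {ω | (ω, n) ∈ B} = 0 := by
  rw [hikMeasure_apply p hB, ENNReal.tsum_eq_zero]
  simp [levelMass_ne_zero hp0 hp1]

/-! ### First occurrences and invariance of the measure -/

/-- The sequences which start with `k` digits `!b`, followed by the digit `b`. -/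
def firstAt (b : Bool) (k : ℕ) : Set (ℕ → Bool) := {ω | (∀ j < k, ω j = !b) ∧ ω k = b}

lemma measurableSet_firstAt (b : Bool) (k : ℕ) : MeasurableSet (firstAt b k) := by
  have : firstAt b k = (⋂ j ∈ Finset.range k, {ω | ω j = !b}) ∩ {ω | ω k = b} := by
    ext ω; simp [firstAt]
  rw [this]
  refine .inter (Finset.measurableSet_biInter _ fun j _ => ?_) ?_
  · exact measurableSet_eq_fun (measurable_pi_apply j) measurable_const
  · exact measurableSet_eq_fun (measurable_pi_apply k) measurable_const

lemma pairwise_disjoint_firstAt (b : Bool) : Pairwise (Function.onFun Disjoint (firstAt b)) := by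
  refine (pairwise_disjoint_on _).2 fun j k hjk => Set.disjoint_left.2 fun ω h1 h2 => ?_
  have := h1.2.symm.trans (h2.1 j hjk)
  simp at this

lemma iUnion_firstAt (b : Bool) : ⋃ k, firstAt b k = {fun _ => !b}ᶜ := by
  ext ω
  simp only [Set.mem_iUnion, Set.mem_compl_iff, Set.mem_singleton_iff]
  constructor
  · rintro ⟨k, -, hk⟩ rfl
    simp at hk
  · intro h
    obtain ⟨m, hm⟩ : ∃ m, ω m = b := by
      by_contra! hne
      exact h (funext fun i => by simpa [Bool.eq_not_iff] using hne i)
    classical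
    have hex : ∃ m, ω m = b := ⟨m, hm⟩
    exact ⟨Nat.find hex, fun j hj => Bool.eq_not_iff.2 (Nat.find_min hex hj), Nat.find_spec hex⟩

lemma consDigit_preimage_firstAt_zero (b c : Bool) :
    consDigit c ⁻¹' firstAt b 0 = if c = b then Set.univ else ∅ := by
  ext u
  by_cases h : c = b <;> simp [firstAt, h]

lemma consDigit_preimage_firstAt_succ (b c : Bool) (k : ℕ) :
    consDigit c ⁻¹' firstAt b (k + 1) = if c = b then ∅ else firstAt b k := by
  ext u
  have : (∀ j < k + 1, consDigit c u j = !b) ↔ c = (!b) ∧ ∀ j < k, u j = !b := by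
    rw [Nat.forall_lt_succ_left]
    simp
  simp only [Set.mem_preimage, firstAt, Set.mem_ofPred_eq, this, consDigit_succ]
  by_cases h : c = b
  · simp [h]
  · simp [Bool.eq_not_iff.2 h]

lemma measurable_addingMachine : Measurable addingMachine := by
  refine measurable_pi_iff.2 fun i => ?_
  have h1 : MeasurableSet {ω : ℕ → Bool | ∀ j ≤ i, ω j = true} := by
    have : {ω : ℕ → Bool | ∀ j ≤ i, ω j = true} = ⋂ j ∈ Finset.Iic i, {ω | ω j = true} := by
      ext; simp
    rw [this]
    exact Finset.measurableSet_biInter _ fun j _ =>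
      measurableSet_eq_fun (measurable_pi_apply j) measurable_const
  have h2 : MeasurableSet {ω : ℕ → Bool | ∀ j < i, ω j = true} := by
    have : {ω : ℕ → Bool | ∀ j < i, ω j = true} = ⋂ j ∈ Finset.Iio i, {ω | ω j = true} := by
      ext; simp
    rw [this]
    exact Finset.measurableSet_biInter _ fun j _ =>
      measurableSet_eq_fun (measurable_pi_apply j) measurable_const
  exact Measurable.ite h1 measurable_const (Measurable.ite h2 measurable_const
    (measurable_pi_apply i))

lemma firstZero_of_mem_firstAt {ω : ℕ → Bool} {k : ℕ} (h : ω ∈ firstAt false k) :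
    firstZero ω = k + 1 :=
  firstZero_eq_of h.1 h.2

lemma measurable_firstZero : Measurable firstZero := by
  refine measurable_to_countable' fun n => ?_
  -- The all-ones sequence has `firstZero` equal to 1 by the default `sInf ∅ = 0`, so it joins the
  -- fibre of 1.
  have : firstZero ⁻¹' {n} = (⋃ k ∈ {k | k + 1 = n}, firstAt false k) ∪
      ({fun _ => true} ∩ {_ω | n = 1}) := by
    ext ω
    by_cases h : ω = fun _ => true
    · subst h
      have h1 : firstZero (fun _ => true) = 1 := by simp [firstZero]
      simp only [Set.mem_preimage, h1, Set.mem_singleton_iff, Set.mem_union, Set.mem_inter_iff,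
        Set.mem_ofPred_eq, true_and]
      simp only [firstAt, Set.mem_iUnion, Set.mem_ofPred_eq, Bool.true_eq_false, and_false,
        exists_false, false_or]
      exact eq_comm
    · have h' : ω ∈ ⋃ k, firstAt false k := by rw [iUnion_firstAt]; simpa using h
      obtain ⟨k, hk⟩ := Set.mem_iUnion.1 h'
      simp only [Set.mem_preimage, firstZero_of_mem_firstAt hk, Set.mem_singleton_iff,
        Set.mem_union, Set.mem_iUnion, Set.mem_ofPred_eq, Set.mem_inter_iff, h, false_and, or_false]
      refine ⟨fun e => ⟨k, e, hk⟩, ?_⟩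
      rintro ⟨j, rfl, hj⟩
      rw [← firstZero_of_mem_firstAt hk, firstZero_of_mem_firstAt hj]
  rw [this]
  exact .union (.biUnion (Set.to_countable _) fun k _ => measurableSet_firstAt _ _)
    ((measurableSet_singleton _).inter (.const _))

lemma measurable_hikMap : Measurable hikMap := by
  have : Measurable fun ω => hikCocycle ω :=
    (measurable_from_nat (f := fun n : ℕ => (n : ℤ) - 2)).comp measurable_firstZero
  exact (measurable_addingMachine.comp measurable_fst).prodMk
    (measurable_snd.add (this.comp measurable_fst))

/-- The adding machine carries `{ℓ = k + 1}` onto the sequences whose first digit `1` is the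
`(k + 1)`-st, and scales the measure by a constant. -/
lemma levelMass_mul_coinMeasure_firstAt {p : unitInterval} (hp0 : 0 < (p : ℝ))
    (hp1 : (p : ℝ) < 1) (k : ℕ) : ∀ (n : ℤ) {A : Set (ℕ → Bool)}, MeasurableSet A →
    levelMass p n * coinMeasure p (firstAt false k ∩ addingMachine ⁻¹' A) =
      levelMass p (n + k - 1) * coinMeasure p (firstAt true k ∩ A) := by
  have pre : ∀ b, addingMachine ∘ consDigit b =
      if b then consDigit false ∘ addingMachine else consDigit true := by
    intro b
    cases b
    · exact funext addingMachine_consDigit_false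
    · exact funext addingMachine_consDigit_true
  induction k with
  | zero =>
    intro n A hA
    rw [coinMeasure_apply p ((measurableSet_firstAt _ _).inter (measurable_addingMachine hA)),
      coinMeasure_apply p ((measurableSet_firstAt _ _).inter hA)]
    simp only [Set.preimage_inter, consDigit_preimage_firstAt_zero, ← Set.preimage_comp, pre]
    have := levelMass_mul_digitMass hp0 hp1 (n - 1)
    rw [sub_add_cancel] at this
    simp [← mul_assoc, this]
  | succ k ih =>
    intro n A hA
    rw [coinMeasure_apply p ((measurableSet_firstAt _ _).inter (measurable_addingMachine hA)),
      coinMeasure_apply p ((measurableSet_firstAt _ _).inter hA)]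
    simp only [Set.preimage_inter, consDigit_preimage_firstAt_succ, ← Set.preimage_comp, pre]
    -- The induction hypothesis handles the tail; detailed balance then pays for the leading digit
    -- changing from 1 to 0, which raises the level by one more.
    have h1 := ih n (measurable_consDigit false hA)
    have h2 := levelMass_mul_digitMass hp0 hp1 (n + k - 1)
    rw [sub_add_cancel] at h2
    rw [← Set.preimage_comp] at h1
    have e : n + ((k + 1 : ℕ) : ℤ) - 1 = n + k := by push_cast; ring
    simp only [e, Bool.true_eq_false, if_false, if_true, Set.empty_inter, measure_empty, mul_zero,
      add_zero, zero_add, Bool.false_eq_true]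
    rw [← mul_assoc, ← mul_assoc, h2, mul_right_comm, h1, mul_right_comm]

lemma coinMeasure_eq_tsum_firstAt {p : unitInterval} (hp0 : 0 < (p : ℝ)) (hp1 : (p : ℝ) < 1)
    (b : Bool) {A : Set (ℕ → Bool)} (hA : MeasurableSet A) :
    coinMeasure p A = ∑' k, coinMeasure p (firstAt b k ∩ A) := by
  rw [← measure_iUnion (fun i j hij => (pairwise_disjoint_firstAt b hij).mono
    Set.inter_subset_left Set.inter_subset_left) fun k => (measurableSet_firstAt b k).inter hA,
    ← Set.iUnion_inter, iUnion_firstAt]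
  have h0 : coinMeasure p {fun _ => !b} = 0 :=
    measure_mono_null (by rintro _ rfl m _; rfl) (coinMeasure_eventually_eq hp0 hp1 (fun _ => !b) 0)
  rw [Set.inter_comm, ← Set.sdiff_eq, measure_sdiff_null h0]

/-- On the piece ℓ = k + 1 the level changes by exactly k - 1, so a shift of the summation over
levels matches source and image piece by piece. -/
lemma measurePreserving_hikMap {p : unitInterval} (hp0 : 0 < (p : ℝ)) (hp1 : (p : ℝ) < 1) :
    MeasurePreserving hikMap (hikMeasure p) (hikMeasure p) := by
  refine ⟨measurable_hikMap, Measure.ext fun B hB => ?_⟩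
  rw [Measure.map_apply measurable_hikMap hB, hikMeasure_apply p (measurable_hikMap hB),
    hikMeasure_apply p hB]
  calc ∑' n, levelMass p n * coinMeasure p {ω | (ω, n) ∈ hikMap ⁻¹' B}
      = ∑' n, ∑' k : ℕ, levelMass p n * coinMeasure p (firstAt false k ∩
          addingMachine ⁻¹' {ω | (ω, n + k - 1) ∈ B}) := by
        refine tsum_congr fun n => ?_
        rw [coinMeasure_eq_tsum_firstAt hp0 hp1 false
          (measurableSet_level (measurable_hikMap hB) n), ENNReal.tsum_mul_left]
        congr 1
        refine tsum_congr fun k => congrArg _ (Set.ext fun ω => and_congr_right fun hω => ?_)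
        have : n + hikCocycle ω = n + k - 1 := by
          rw [hikCocycle, firstZero_of_mem_firstAt hω]
          push_cast
          ring
        simp only [Set.mem_ofPred_eq, Set.mem_preimage, hikMap, this]
    _ = ∑' k : ℕ, ∑' n, levelMass p (n + k - 1) * coinMeasure p (firstAt true k ∩
          {ω | (ω, n + k - 1) ∈ B}) := by
        rw [ENNReal.tsum_comm]
        exact tsum_congr fun k => tsum_congr fun n =>
          levelMass_mul_coinMeasure_firstAt hp0 hp1 k n (measurableSet_level hB _)
    _ = ∑' k : ℕ, ∑' n, levelMass p n * coinMeasure p (firstAt true k ∩ {ω | (ω, n) ∈ B}) := by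
        refine tsum_congr fun k => ?_
        rw [← (Equiv.addRight ((k : ℤ) - 1)).tsum_eq fun n =>
          levelMass p n * coinMeasure p (firstAt true k ∩ {ω | (ω, n) ∈ B})]
        refine tsum_congr fun n => ?_
        simp only [Equiv.coe_addRight, add_sub_assoc]
    _ = ∑' n, levelMass p n * coinMeasure p {ω | (ω, n) ∈ B} := by
        rw [ENNReal.tsum_comm]
        refine tsum_congr fun n => ?_
        rw [ENNReal.tsum_mul_left,
          ← coinMeasure_eq_tsum_firstAt hp0 hp1 true (measurableSet_level hB n)]

end HIKMeasure

/-! ### Ergodicity and conservativity -/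

section Ergodicity

variable {p : unitInterval}

/-- A block exchange preserves the tail and the number of ones, so the orbit criterion applies at
equal heights. Either point may come first, as only forward iterates are used. -/
lemma exists_same_orbit (hp0 : 0 < (p : ℝ)) (hp1 : (p : ℝ) < 1) {s t : Set (ℕ → Bool)}
    (hs : MeasurableSet s) (ht : MeasurableSet t) (hs0 : coinMeasure p s ≠ 0)
    (ht0 : coinMeasure p t ≠ 0) (n : ℤ) :
    ∃ ω ∈ s, ∃ ω' ∈ t, (∃ k, hikMap^[k] (ω, n) = (ω', n)) ∨ ∃ k, hikMap^[k] (ω', n) = (ω, n) := by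
  obtain ⟨K, hK⟩ := exists_blockSwap_inter_ne_zero p hs ht hs0 ht0
  obtain ⟨ω, ⟨h1, h2⟩, hω⟩ := ((frequently_ae_mem_iff.2 hK).and_eventually
    (ae_mem_infZeros hp0 hp1)).exists
  refine ⟨ω, h1, _, h2, exists_iterate_hikMap_eq (2 * K) ω _ n n hω (fun i hi => ?_) ?_⟩
  · have h3 : ¬ i < K := by omega
    have h4 : ¬ i < 2 * K := by omega
    simp only [blockSwapFun, if_neg h3, if_neg h4]
  · rw [onesCount_blockSwap]

lemma coinMeasure_firstAt_ne_zero (hp0 : 0 < (p : ℝ)) (hp1 : (p : ℝ) < 1) (b : Bool) (k : ℕ) :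
    coinMeasure p (firstAt b k) ≠ 0 := by
  induction k with
  | zero =>
    rw [coinMeasure_apply p (measurableSet_firstAt _ _)]
    cases b <;> simp [consDigit_preimage_firstAt_zero, digitMass_ne_zero hp0 hp1]
  | succ k ih =>
    rw [coinMeasure_apply p (measurableSet_firstAt _ _)]
    cases b <;> simp [consDigit_preimage_firstAt_succ, digitMass_ne_zero hp0 hp1, ih]

lemma iterate_mem_iff_of_preimage_eq {X : Type*} {f : X → X} {s : Set X} (hs : f ⁻¹' s = s)
    (k : ℕ) (x : X) : f^[k] x ∈ s ↔ x ∈ s := by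
  rw [← Set.mem_preimage, Set.preimage_iterate_eq, Function.iterate_fixed hs]

/-- The sections of an invariant set are trivial. -/
lemma level_null_or_compl_null (hp0 : 0 < (p : ℝ)) (hp1 : (p : ℝ) < 1)
    {s : Set ((ℕ → Bool) × ℤ)} (hs : MeasurableSet s) (hT : hikMap ⁻¹' s = s) (n : ℤ) :
    coinMeasure p {ω | (ω, n) ∈ s} = 0 ∨ coinMeasure p {ω | (ω, n) ∈ s}ᶜ = 0 := by
  by_contra! h
  obtain ⟨ω, h1, ω', h2, ⟨k, hk⟩ | ⟨k, hk⟩⟩ := exists_same_orbit hp0 hp1 (measurableSet_level hs n)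
    (measurableSet_level hs n).compl h.1 h.2 n
  · exact h2 (show (ω', n) ∈ s from hk ▸ (iterate_mem_iff_of_preimage_eq hT k _).2 h1)
  · refine h2 ((iterate_mem_iff_of_preimage_eq hT k _).1 ?_)
    rw [hk]
    exact h1

/-- The set ℓ = k + 1 has positive measure and carries level `m` to level `n`. If the section at `m`
were full, invariance would send a set of positive measure into the null section at `n`. -/
lemma level_null_of_level_null (hp0 : 0 < (p : ℝ)) (hp1 : (p : ℝ) < 1)
    {s : Set ((ℕ → Bool) × ℤ)} (hs : MeasurableSet s) (hT : hikMap ⁻¹' s = s) {n : ℤ}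
    (h0 : coinMeasure p {ω | (ω, n) ∈ s} = 0) (k : ℕ) {m : ℤ} (hm : m + k - 1 = n) :
    coinMeasure p {ω | (ω, m) ∈ s} = 0 := by
  refine (level_null_or_compl_null hp0 hp1 hs hT m).resolve_right fun hc => ?_
  set B : Set ((ℕ → Bool) × ℤ) := s ∩ Prod.snd ⁻¹' {n} with hB
  have mB : MeasurableSet B := hs.inter (measurable_snd .of_discrete)
  have h1 : hikMeasure p B = 0 := by
    refine (hikMeasure_eq_zero_iff hp0 hp1 mB).2 fun j => ?_
    by_cases hj : j = n
    · subst hj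
      exact measure_mono_null (fun ω h => h.1) h0
    · convert measure_empty (μ := coinMeasure p)
      ext ω
      simp [hB, hj]
  rw [← (measurePreserving_hikMap hp0 hp1).measure_preimage mB.nullMeasurableSet,
    hikMeasure_eq_zero_iff hp0 hp1 (measurable_hikMap mB)] at h1
  refine coinMeasure_firstAt_ne_zero hp0 hp1 false k
    (measure_mono_null (fun ω hω => ?_) (measure_union_null (h1 m) hc))
  by_cases h : (ω, m) ∈ s
  · refine Or.inl ⟨?_, ?_⟩
    · change (ω, m) ∈ hikMap ⁻¹' s
      rwa [hT]
    · change m + hikCocycle ω = n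
      rw [hikCocycle, firstZero_of_mem_firstAt hω, ← hm]
      push_cast
      ring
  · exact Or.inr h

lemma hikMeasure_eq_zero_of_level_null (hp0 : 0 < (p : ℝ)) (hp1 : (p : ℝ) < 1)
    {s : Set ((ℕ → Bool) × ℤ)} (hs : MeasurableSet s) (hT : hikMap ⁻¹' s = s)
    (h0 : coinMeasure p {ω | (ω, (0 : ℤ)) ∈ s} = 0) : hikMeasure p s = 0 := by
  refine (hikMeasure_eq_zero_iff hp0 hp1 hs).2 fun n => ?_
  induction n with
  | zero => exact h0
  -- Transitions with `k = 0` go one level down and those with `k = 2` one level up, so nullity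
  -- spreads from level 0 both ways.
  | succ i ih => exact level_null_of_level_null hp0 hp1 hs hT ih 0 (by simp)
  | pred i ih => exact level_null_of_level_null hp0 hp1 hs hT ih 2 (by push_cast; ring)

lemma ergodic_hikMap (hp0 : 0 < (p : ℝ)) (hp1 : (p : ℝ) < 1) :
    Ergodic hikMap (hikMeasure p) where
  toMeasurePreserving := measurePreserving_hikMap hp0 hp1
  aeconst_set := fun s hs hT => by
    rw [Filter.eventuallyConst_set']
    rcases level_null_or_compl_null hp0 hp1 hs hT 0 with h | h
    · exact Or.inl (ae_eq_empty.2 (hikMeasure_eq_zero_of_level_null hp0 hp1 hs hT h))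
    · refine Or.inr (ae_eq_univ.2 (hikMeasure_eq_zero_of_level_null hp0 hp1 hs.compl ?_ h))
      rw [Set.preimage_compl, hT]

lemma conservative_hikMap (hp0 : 0 < (p : ℝ)) (hp1 : (p : ℝ) < 1) :
    Conservative hikMap (hikMeasure p) where
  toQuasiMeasurePreserving := (measurePreserving_hikMap hp0 hp1).quasiMeasurePreserving
  exists_mem_iterate_mem' := fun s hs h0 => by
    obtain ⟨n, hn⟩ := not_forall.1 (mt (hikMeasure_eq_zero_iff hp0 hp1 hs).2 h0)
    -- Differing at digit `i` makes the two points distinct, so the number of steps joining them is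
    -- nonzero.
    obtain ⟨i, hi⟩ := exists_digit_split hp0 hp1 hn
    have meas : ∀ b, MeasurableSet ({ω | (ω, n) ∈ s} ∩ {ω : ℕ → Bool | ω i = b}) := fun b =>
      (measurableSet_level hs n).inter
        (measurableSet_eq_fun (measurable_pi_apply i) measurable_const)
    obtain ⟨ω, ⟨h1, h1'⟩, ω', ⟨h2, h2'⟩, h⟩ :=
      exists_same_orbit hp0 hp1 (meas true) (meas false) (hi true) (hi false) n
    have hne : ω ≠ ω' := by
      rintro rfl
      exact Bool.true_eq_false_eq_False (h1'.symm.trans h2')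
    rcases h with ⟨k, hk⟩ | ⟨k, hk⟩
    · refine ⟨_, h1, k, ?_, hk ▸ h2⟩
      rintro rfl
      exact hne (Prod.mk.inj hk).1
    · refine ⟨_, h2, k, ?_, hk ▸ h1⟩
      rintro rfl
      exact hne (Prod.mk.inj hk).1.symm

end Ergodicity

/-! ### Log-lower boundedness -/

section ReturnTime

lemma returnTime_le {X : Type*} {T : X → X} {A : Set X} {x : X} {n : ℕ} (hn : 1 ≤ n)
    (h : T^[n] x ∈ A) : returnTime T A x ≤ n :=
  iInf₂_le n ⟨hn, h⟩

/-- The sequences none of whose first `k` pairs of digits is `1, 0`. -/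
def noDescent : ℕ → Set (ℕ → Bool)
  | 0 => Set.univ
  | k + 1 => {ω | ¬ (ω 0 = true ∧ ω 1 = false) ∧ (fun i => ω (i + 2)) ∈ noDescent k}

lemma measurableSet_noDescent (k : ℕ) : MeasurableSet (noDescent k) := by
  induction k with
  | zero => exact .univ
  | succ k ih =>
    refine .inter (.compl (.inter ?_ ?_)) (ih.preimage (by fun_prop))
    · exact measurableSet_eq_fun (measurable_pi_apply 0) measurable_const
    · exact measurableSet_eq_fun (measurable_pi_apply 1) measurable_const

lemma exists_descent_of_notMem (k : ℕ) : ∀ ω : ℕ → Bool, ω ∉ noDescent k →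
    ∃ i ≤ 2 * k, ω i = true ∧ ω (i + 1) = false := by
  induction k with
  | zero => exact fun ω h => (h trivial).elim
  | succ k ih =>
    intro ω h
    by_cases h0 : ω 0 = true ∧ ω 1 = false
    · exact ⟨0, by omega, h0⟩
    · obtain ⟨i, hi, h⟩ := ih (fun i => ω (i + 2)) fun h' => h ⟨h0, h'⟩
      exact ⟨i + 2, by omega, h⟩

/-- Disjoint pairs are independent, and each avoids 1, 0 either as 1, 1 or by starting with 0. -/
lemma coinMeasure_noDescent (p : unitInterval) (k : ℕ) :
    coinMeasure p (noDescent k) = (digitMass p true ^ 2 + digitMass p false) ^ k := by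
  induction k with
  | zero => simp [noDescent]
  | succ k ih =>
    have h11 : consDigit true ⁻¹' (consDigit true ⁻¹' noDescent (k + 1)) = noDescent k := by
      ext u; simp [noDescent]
    have h10 : consDigit false ⁻¹' (consDigit true ⁻¹' noDescent (k + 1)) = ∅ := by
      ext u; simp [noDescent]
    have h0 : ∀ b, consDigit b ⁻¹' (consDigit false ⁻¹' noDescent (k + 1)) = noDescent k := by
      intro b; ext u; simp [noDescent]
    have m := measurableSet_noDescent (k + 1)
    rw [coinMeasure_apply p m, coinMeasure_apply p (measurable_consDigit true m),
      coinMeasure_apply p (measurable_consDigit false m), h11, h10, h0, h0, ← add_mul,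
      digitMass_add, one_mul, measure_empty, mul_zero, add_zero, ih]
    ring

/-- If the first descent among the pairs is found by stage `k`, the return takes at most 2^(2k) =
4^k steps, and the terms 0, …, k - 1 of the sum are all 1. If there is none, the sum is infinite. -/
lemma logReturnTime_le {ω : ℕ → Bool} (hω : ω ∈ infZeros) (n : ℤ) :
    logReturnTime hikMap (Prod.snd ⁻¹' {n}) (ω, n) ≤
      (ENNReal.log 4).toENNReal * ∑' k, (noDescent k).indicator (fun _ => 1) ω := by
  have log4 : 0 < ENNReal.log 4 := by simp
  by_cases hall : ∀ k, ω ∈ noDescent k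
  · have : ∑' k, (noDescent k).indicator (fun _ => (1 : ℝ≥0∞)) ω = ∞ := by
      simp [hall]
    rw [this, ENNReal.mul_top]
    · exact le_top
    · exact EReal.toENNReal_ne_zero_iff.2 log4
  · classical
    push Not at hall
    set k := Nat.find hall
    have hlt : ∀ j < k, ω ∈ noDescent j := fun j hj => by simpa using Nat.find_min hall hj
    obtain ⟨i, hi, h1, h0⟩ := exists_descent_of_notMem k ω (Nat.find_spec hall)
    have hret : returnTime hikMap (Prod.snd ⁻¹' {n}) (ω, n) ≤ ((2 ^ i : ℕ) : ℕ∞) :=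
      returnTime_le Nat.one_le_two_pow (iterate_two_pow_hikMap_snd i ω n hω h1 h0)
    have hpow : ((returnTime hikMap (Prod.snd ⁻¹' {n}) (ω, n) : ℕ∞) : ℝ≥0∞) ≤ 4 ^ k := by
      refine (ENat.toENNReal_le.2 hret).trans ?_
      calc (((2 ^ i : ℕ) : ℕ∞) : ℝ≥0∞) = 2 ^ i := by simp
        _ ≤ 2 ^ (2 * k) := pow_le_pow_right₀ (by norm_num) hi
        _ = 4 ^ k := by rw [pow_mul]; norm_num
    have hsum : (k : ℝ≥0∞) ≤ ∑' k, (noDescent k).indicator (fun _ => (1 : ℝ≥0∞)) ω := by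
      refine le_trans (le_of_eq ?_) (ENNReal.sum_le_tsum (Finset.range k))
      rw [Finset.sum_congr rfl fun j hj =>
        Set.indicator_of_mem (hlt j (Finset.mem_range.1 hj)) (fun _ => (1 : ℝ≥0∞))]
      simp
    calc logReturnTime hikMap (Prod.snd ⁻¹' {n}) (ω, n)
        ≤ (ENNReal.log (4 ^ k)).toENNReal := EReal.toENNReal_le_toENNReal (ENNReal.log_monotone hpow)
      _ = (ENNReal.log 4).toENNReal * k := by
          rw [ENNReal.log_pow, EReal.toENNReal_mul (by positivity), mul_comm]
          exact congrArg _ (EReal.toENNReal_coe (x := (k : ℝ≥0∞)))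
      _ ≤ _ := by gcongr

lemma level_mem_logSets {p : unitInterval} (hp0 : 0 < (p : ℝ)) (hp1 : (p : ℝ) < 1) :
    Prod.snd ⁻¹' {(0 : ℤ)} ∈ logSets hikMap (hikMeasure p) := by
  have mA : MeasurableSet (Prod.snd ⁻¹' {(0 : ℤ)} : Set ((ℕ → Bool) × ℤ)) :=
    measurable_snd .of_discrete
  have hprod : ∀ B : Set (ℕ → Bool), MeasurableSet B →
      hikMeasure p (Prod.fst ⁻¹' B ∩ Prod.snd ⁻¹' {(0 : ℤ)}) = coinMeasure p B := by
    intro B hB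
    rw [hikMeasure_apply p ((measurable_fst hB).inter mA), tsum_eq_single 0]
    · simp [levelMass]
    · intro n hn
      simp [hn]
  have hA : hikMeasure p (Prod.snd ⁻¹' {(0 : ℤ)}) = 1 := by
    simpa using hprod Set.univ .univ
  refine ⟨mA, by simp [hA], by simp [hA], ?_⟩
  -- This is p² + q < p + q = 1, the ratio of the geometric series that bounds the integral.
  have hq : digitMass p true ^ 2 + digitMass p false < 1 := by
    rw [← digitMass_add p]
    refine ENNReal.add_lt_add_right (digitMass_ne_top _ _) ?_
    rw [sq]
    simpa using ENNReal.mul_lt_mul_right (digitMass_ne_zero hp0 hp1 true) (digitMass_ne_top p true)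
      (digitMass_lt_one hp0 hp1 true)
  have hnull : hikMeasure p (Prod.fst ⁻¹' infZeros)ᶜ = 0 := by
    have h := ae_mem_infZeros hp0 hp1
    exact (Measure.quasiMeasurePreserving_fst (μ := coinMeasure p) (ν := heightMeasure p)).ae h
  calc ∫⁻ x in Prod.snd ⁻¹' {(0 : ℤ)}, logReturnTime hikMap (Prod.snd ⁻¹' {0}) x ∂hikMeasure p
      ≤ ∫⁻ x in Prod.snd ⁻¹' {(0 : ℤ)}, (ENNReal.log 4).toENNReal *
          ∑' k, (Prod.fst ⁻¹' noDescent k).indicator (fun _ => 1) x ∂hikMeasure p := by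
        refine lintegral_mono_ae ?_
        have h1 : ∀ᵐ x ∂(hikMeasure p).restrict (Prod.snd ⁻¹' {(0 : ℤ)}), x.1 ∈ infZeros :=
          ae_restrict_of_ae hnull
        filter_upwards [h1, ae_restrict_mem mA] with x hx hx0
        obtain ⟨ω, n⟩ := x
        obtain rfl : n = 0 := hx0
        exact logReturnTime_le hx 0
    _ = (ENNReal.log 4).toENNReal * ∑' k, coinMeasure p (noDescent k) := by
        have mk : ∀ k, MeasurableSet (Prod.fst ⁻¹' noDescent k : Set ((ℕ → Bool) × ℤ)) :=
          fun k => measurable_fst (measurableSet_noDescent k)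
        rw [lintegral_const_mul _ (Measurable.tsum fun k =>
            measurable_const.indicator (mk k)),
          lintegral_tsum fun k => (measurable_const.indicator (mk k)).aemeasurable]
        congr 1
        refine tsum_congr fun k => ?_
        rw [lintegral_indicator_const (mk k), one_mul, Measure.restrict_apply (mk k),
          hprod _ (measurableSet_noDescent k)]
    _ < ∞ := by
        simp only [coinMeasure_noDescent, ENNReal.tsum_geometric]
        refine ENNReal.mul_lt_top ?_ ?_
        · rw [lt_top_iff_ne_top, ne_eq, EReal.toENNReal_eq_top_iff]
          simp
        · rw [ENNReal.inv_lt_top]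
          exact tsub_pos_of_lt hq

end ReturnTime

theorem proposition3p3 (p : ℝ) (hp0 : 0 < p) (hp1 : p < 1) :
    IsLLB hikMap (hikMeasure ⟨p, hp0.le, hp1.le⟩) where
  sigmaFinite := inferInstance
  conservative := conservative_hikMap hp0 hp1
  ergodic := ergodic_hikMap hp0 hp1
  nonempty_logSets := ⟨_, level_mem_logSets hp0 hp1⟩
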